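/- Let $\mathbb{D}$ be the open unit disc. Let $H^2$ be the Hardy space of holomorphic functions $f$ on $\mathbb{D}$ with $\|f\|^2=\sup_{0\le r<1}\frac1{2\pi}\int_0^{2\pi}|f(re^{i\theta})|^2\,d\theta<\infty$, a Hilbert space with inner product $\langle f,g\rangle=\sum_{n\ge0}a_n\overline{b_n}$ in terms of the Maclaurin coefficients $(a_n)$ of $f$ and $(b_n)$ of $g$, and let $H^\infty$ be the algebra of bounded holomorphic functions on $\mathbb{D}$. A function $h\in H^2$ is called outer if it is a cyclic vector for the shift $(Sf)(z)=zf(z)$ on $H^2$. The Smirnov class $N^+$ is the algebra of all quotients $g/h$ with $g,h\in H^\infty$ and $h$ outer. For $b$ in the closed unit ball of $H^\infty$, let $T_b$ be multiplication by $b$ on $H^2$; the de Branges–Rovnyak space $\mathcal{H}(b)$ is the range of $(I-T_bT_b^*)^{1/2}$ on $H^2$. For $k\ge2$ put $$h_k(z)=\frac{1}{1-z}\log\left(\frac{1+z+\dots+z^{k-1}}{k}\right)\in H^2,$$ and let $\mathcal{N}$ be the linear span of $\{h_k:k\ge2\}$ in $H^2$. Let $\varphi$ be a unit of $N^+$ (that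 is, $\varphi\in N^+$ and $1/\varphi\in N^+$), and let $(b,a)$ be its Pythagorean pair: $b$ lies in the closed unit ball of $H^\infty$, $a\in H^\infty$ is outer with $a(0)>0$, the radial limits satisfy $|a^*|^2+|b^*|^2=1$ almost everywhere on the unit circle, and $\varphi=b/a$ on $\mathbb{D}$. If the sequence $(h_k/\varphi)_{k\ge2}$ is complete in $H^2$ (each $h_k/\varphi$ belongs to $H^2$, and their linear span is dense in $H^2$), then $$\mathcal{N}^\perp\cap\mathcal{H}(b)=\{0\}.$$ -/

import Mathlib

namespace HardyDisc

noncomputable section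

open MeasureTheory Filter Topology Complex
open scoped Complex.UnitDisc ComplexConjugate Real

/-- Parseval's identity for absolutely convergent one-sided Fourier series. -/
theorem parseval_aux (a : ℕ → ℂ) (ha : Summable fun n => ‖a n‖) (F : ℝ → ℂ)
    (hF : ∀ θ : ℝ, HasSum (fun n : ℕ => a n * exp (n * θ * I)) (F θ)) :
    HasSum (fun n => ‖a n‖ ^ 2) ((2 * π)⁻¹ • ∫ θ in (0 : ℝ)..2 * π, ‖F θ‖ ^ 2) := by
  have : Fact (0 < 2 * π) := ⟨Real.two_pi_pos⟩
  let v : ℕ → C(AddCircle (2 * π), ℂ) := fun n => fourier (n : ℤ)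
  have hs : Summable fun n => a n • v n := by
    refine Summable.of_norm ?_
    simpa [v, norm_smul, fourier_norm] using ha
  obtain ⟨G, hG⟩ := hs
  have hGF : ∀ θ : ℝ, G (θ : AddCircle (2 * π)) = F θ := by
    intro θ
    have h1 := ((ContinuousMap.evalCLM ℂ (θ : AddCircle (2 * π))).hasSum hG)
    refine h1.unique ?_
    convert hF θ using 2 with n
    simp only [ContinuousMap.evalCLM_apply, ContinuousMap.smul_apply, smul_eq_mul, v,
      fourier_coe_apply]
    congr 2
    have : (π : ℂ) ≠ 0 := by exact_mod_cast Real.pi_ne_zero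
    push_cast
    field_simp
  let Φ := ContinuousMap.toLp (E := ℂ) 2 (AddCircle.haarAddCircle (T := 2 * π)) ℂ
  have hL : HasSum (fun n => a n • Φ (v n)) (Φ G) := by
    have := Φ.hasSum hG
    simpa only [Function.comp_def, map_smul] using this
  have hv : Orthonormal ℂ fun n : ℕ => Φ (v n) :=
    (orthonormal_fourier (T := 2 * π)).comp (fun n : ℕ => (n : ℤ)) Nat.cast_injective
  have hc : ∀ m, inner ℂ (Φ (v m)) (Φ G) = a m := by
    intro m
    have h1 := (innerSL ℂ (Φ (v m))).hasSum hL
    refine h1.unique ?_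
    convert hasSum_ite_eq m (a m) using 2 with n
    · rfl
    simp only [innerSL_apply_apply, inner_smul_right]
    rw [orthonormal_iff_ite.1 hv]
    by_cases h : m = n
    · simp [h]
    · simp [h, Ne.symm h]
  have h2 : HasSum (fun n => ((‖a n‖ ^ 2 : ℝ) : ℂ)) (inner ℂ (Φ G) (Φ G)) := by
    have h1 := (innerSL ℂ (Φ G)).hasSum hL
    convert h1 using 2 with n
    · rfl
    · simp only [innerSL_apply_apply, inner_smul_right]
      rw [← inner_conj_symm, hc, Complex.mul_conj, Complex.normSq_eq_norm_sq]
    · rfl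
  have h3 : inner ℂ (Φ G) (Φ G) = (((2 * π)⁻¹ • ∫ θ in (0 : ℝ)..2 * π, ‖F θ‖ ^ 2 : ℝ) : ℂ) := by
    rw [ContinuousMap.inner_toLp]
    simp_rw [Complex.mul_conj, Complex.normSq_eq_norm_sq]
    rw [integral_complex_ofReal, AddCircle.integral_haarAddCircle]
    rw [← AddCircle.intervalIntegral_preimage (2 * π) 0]
    simp [hGF]
  rw [h3] at h2
  exact_mod_cast h2

/-- Extension by zero of a function on the open unit disc. -/
def zeroExt (f : 𝔻 → ℂ) (z : ℂ) : ℂ := if h : ‖z‖ < 1 then f (UnitDisc.mk z h) else 0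

/-- `f` is holomorphic on the unit disc. -/
def IsHol (f : 𝔻 → ℂ) : Prop := DifferentiableOn ℂ (zeroExt f) (Metric.ball 0 1)

/-- The `n`-th Maclaurin coefficient of `f`. -/
def taylorCoeff (f : 𝔻 → ℂ) (n : ℕ) : ℂ := iteratedDeriv n (zeroExt f) 0 / (n.factorial : ℂ)

/-- The integral mean `(1 / 2π) ∫ |f(r e^{iθ})|² dθ`. -/
def mean2 (f : 𝔻 → ℂ) (r : ℝ) : ℝ := Real.circleAverage (fun z => ‖zeroExt f z‖ ^ 2) 0 r

theorem zeroExt_coe (f : 𝔻 → ℂ) (z : 𝔻) : zeroExt f z = f z := by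
  simp [zeroExt, z.norm_lt_one]

theorem zeroExt_mk (f : 𝔻 → ℂ) {z : ℂ} (hz : ‖z‖ < 1) : zeroExt f z = f (UnitDisc.mk z hz) := by
  simp [zeroExt, hz]

theorem hasSum_coeff {f : 𝔻 → ℂ} (hf : IsHol f) {z : ℂ} (hz : ‖z‖ < 1) :
    HasSum (fun n => taylorCoeff f n * z ^ n) (zeroExt f z) := by
  have h := Complex.hasSum_taylorSeries_on_ball hf (z := z) (by simpa using hz)
  convert h using 2 with n
  · rfl
  simp [taylorCoeff]; ring

theorem hasSum_mean2 {f : 𝔻 → ℂ} (hf : IsHol f) {r : ℝ} (h0 : 0 ≤ r) (h1 : r < 1) :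
    HasSum (fun n => ‖taylorCoeff f n‖ ^ 2 * r ^ (2 * n)) (mean2 f r) := by
  have hr : ‖(r : ℂ)‖ < 1 := by simpa [abs_of_nonneg h0] using h1
  have hs := (hasSum_coeff hf hr).summable.norm
  have := parseval_aux (fun n => taylorCoeff f n * (r : ℂ) ^ n) hs
    (fun θ => zeroExt f (circleMap 0 r θ)) ?_
  · convert this using 1
    on_goal 1 => ext n
    · simp [mul_pow, abs_of_nonneg h0, pow_mul']
    · rfl
  · intro θ
    have h := hasSum_coeff hf (z := circleMap 0 r θ) (by simpa [abs_of_nonneg h0] using h1)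
    convert h using 2 with n
    rw [circleMap, zero_add, mul_pow, ← Complex.exp_nat_mul]
    ring_nf

theorem coeff_unique {f : 𝔻 → ℂ} {c : ℕ → ℂ}
    (h : ∀ z : 𝔻, HasSum (fun n => c n * (z : ℂ) ^ n) (f z)) :
    IsHol f ∧ taylorCoeff f = c := by
  have hp : HasFPowerSeriesOnBall (zeroExt f) (FormalMultilinearSeries.ofScalars ℂ c) 0 1 := by
    refine ⟨?_, by simp, ?_⟩
    · refine ENNReal.le_of_forall_nnreal_lt fun r hr => ?_
      have hr1 : (r : ℝ) < 1 := by exact_mod_cast hr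
      have h1 := (h (UnitDisc.mk (r : ℂ) (by simpa using hr1))).summable.norm
      refine FormalMultilinearSeries.le_radius_of_summable _ ?_
      simpa [FormalMultilinearSeries.ofScalars_norm] using h1
    · intro y hy
      have hy' : ‖y‖ < 1 := by
        rw [← ENNReal.ofReal_one, Metric.eball_ofReal] at hy
        simpa using hy
      have h1 := h (UnitDisc.mk y hy')
      simp only [FormalMultilinearSeries.ofScalars_apply_eq, zero_add, smul_eq_mul]
      rw [zeroExt_mk f hy']
      simpa using h1
  have hd : IsHol f := by
    have := hp.differentiableOn
    rwa [← ENNReal.ofReal_one, Metric.eball_ofReal] at this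
  refine ⟨hd, ?_⟩
  have hp2 := hp.hasFPowerSeriesAt.eq_formalMultilinearSeries
    (hp.analyticAt.hasFPowerSeriesAt)
  have := (FormalMultilinearSeries.ofScalars_series_injective ℂ ℂ hp2)
  rw [this]
  rfl

theorem summable_of_mean2 {f : 𝔻 → ℂ} (hf : IsHol f) {M : ℝ}
    (hM : ∀ r : ℝ, 0 ≤ r → r < 1 → mean2 f r ≤ M) :
    Summable (fun n => ‖taylorCoeff f n‖ ^ 2) ∧ ∑' n, ‖taylorCoeff f n‖ ^ 2 ≤ M := by
  have key : ∀ s : Finset ℕ, ∑ n ∈ s, ‖taylorCoeff f n‖ ^ 2 ≤ M := by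
    intro s
    have ht : Tendsto (fun r : ℝ => ∑ n ∈ s, ‖taylorCoeff f n‖ ^ 2 * r ^ (2 * n)) (𝓝[<] 1)
        (𝓝 (∑ n ∈ s, ‖taylorCoeff f n‖ ^ 2)) := by
      have : Continuous (fun r : ℝ => ∑ n ∈ s, ‖taylorCoeff f n‖ ^ 2 * r ^ (2 * n)) := by fun_prop
      have h := (this.tendsto 1).mono_left (nhdsWithin_le_nhds (s := Set.Iio 1))
      simpa using h
    refine le_of_tendsto ht ?_
    filter_upwards [Ioo_mem_nhdsLT (show (0 : ℝ) < 1 by norm_num)] with r hr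
    exact (sum_le_hasSum s (fun n _ => by have := hr.1.le; positivity)
      (hasSum_mean2 hf hr.1.le hr.2)).trans (hM r hr.1.le hr.2)
  have hs := summable_of_sum_le (fun n => by positivity) key
  exact ⟨hs, hs.tsum_le_of_sum_le key⟩

theorem mean2_le {f : 𝔻 → ℂ} (hf : IsHol f) (hs : Summable (fun n => ‖taylorCoeff f n‖ ^ 2))
    {r : ℝ} (h0 : 0 ≤ r) (h1 : r < 1) : mean2 f r ≤ ∑' n, ‖taylorCoeff f n‖ ^ 2 := by
  refine hasSum_le (fun n => ?_) (hasSum_mean2 hf h0 h1) hs.hasSum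
  exact mul_le_of_le_one_right (by positivity) (pow_le_one₀ h0 h1.le)

/-- Membership in `H²`: `f` is holomorphic and its integral means are bounded over `0 ≤ r < 1`. -/
def IsHardy (f : 𝔻 → ℂ) : Prop :=
  IsHol f ∧ ∃ M : ℝ, ∀ r : ℝ, 0 ≤ r → r < 1 → mean2 f r ≤ M

theorem isHardy_iff {f : 𝔻 → ℂ} :
    IsHardy f ↔ IsHol f ∧ Summable (fun n => ‖taylorCoeff f n‖ ^ 2) :=
  ⟨fun ⟨h, _, hM⟩ => ⟨h, (summable_of_mean2 h hM).1⟩,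
    fun ⟨h, hs⟩ => ⟨h, _, fun _ h0 h1 => mean2_le h hs h0 h1⟩⟩

theorem memlp_iff {c : ℕ → ℂ} : Memℓp c 2 ↔ Summable (fun n => ‖c n‖ ^ 2) := by
  rw [memℓp_gen_iff (by norm_num)]
  simp

theorem coeff_add {f g : 𝔻 → ℂ} (hf : IsHol f) (hg : IsHol g) :
    IsHol (f + g) ∧ taylorCoeff (f + g) = taylorCoeff f + taylorCoeff g := by
  refine coeff_unique fun z => ?_
  have h := (hasSum_coeff hf z.norm_lt_one).add (hasSum_coeff hg z.norm_lt_one)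
  simpa [add_mul, zeroExt_coe] using h

theorem coeff_smul {f : 𝔻 → ℂ} (c : ℂ) (hf : IsHol f) :
    IsHol (c • f) ∧ taylorCoeff (c • f) = c • taylorCoeff f := by
  refine coeff_unique fun z => ?_
  have h := (hasSum_coeff hf z.norm_lt_one).mul_left c
  simpa [mul_assoc, zeroExt_coe] using h

theorem coeff_zero : IsHol 0 ∧ taylorCoeff 0 = 0 :=
  coeff_unique fun z => by simp

/-- `H²` as a linear space of functions on the unit disc. -/
def hardySubmodule : Submodule ℂ (𝔻 → ℂ) where
  carrier := {f | IsHardy f}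
  add_mem' {f g} hf hg := by
    simp only [Set.mem_ofPred_eq, isHardy_iff, ← memlp_iff] at *
    obtain ⟨h1, h2⟩ := coeff_add hf.1 hg.1
    exact ⟨h1, h2 ▸ hf.2.add hg.2⟩
  zero_mem' := by
    simp only [Set.mem_ofPred_eq, isHardy_iff, ← memlp_iff]
    exact ⟨coeff_zero.1, coeff_zero.2 ▸ zero_memℓp⟩
  smul_mem' c f hf := by
    simp only [Set.mem_ofPred_eq, isHardy_iff, ← memlp_iff] at *
    obtain ⟨h1, h2⟩ := coeff_smul c hf.1
    exact ⟨h1, h2 ▸ hf.2.const_smul c⟩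

/-- `H²` is identified with `ℓ²` through the Maclaurin coefficients. -/
def hardyEquiv : hardySubmodule ≃ₗ[ℂ] lp (fun _ : ℕ => ℂ) 2 :=
  LinearEquiv.ofBijective
    ({ toFun := fun f => ⟨taylorCoeff f.1, memlp_iff.2 (isHardy_iff.1 f.2).2⟩
       map_add' := fun f g => Subtype.ext (coeff_add f.2.1 g.2.1).2
       map_smul' := fun c f => Subtype.ext (coeff_smul c f.2.1).2 } :
      hardySubmodule →ₗ[ℂ] lp (fun _ : ℕ => ℂ) 2) (by
    constructor
    · intro f g h
      have hc : taylorCoeff f.1 = taylorCoeff g.1 := congrArg Subtype.val h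
      refine Subtype.ext (funext fun z => ?_)
      have h1 := hasSum_coeff f.2.1 z.norm_lt_one
      have h2 := hasSum_coeff g.2.1 z.norm_lt_one
      rw [hc] at h1
      simpa [zeroExt_coe] using h1.unique h2
    · intro c
      have hb : ∀ z : 𝔻, Summable fun n => c n * (z : ℂ) ^ n := by
        intro z
        refine Summable.of_norm_bounded (g := fun n => ‖c‖ * ‖(z : ℂ)‖ ^ n)
          ((summable_geometric_of_lt_one (norm_nonneg _) z.norm_lt_one).mul_left _) fun n => ?_
        rw [norm_mul, norm_pow]
        gcongr
        exact lp.norm_apply_le_norm (by norm_num) c n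
      obtain ⟨h1, h2⟩ := coeff_unique (f := fun z : 𝔻 => ∑' n, c n * (z : ℂ) ^ n)
        fun z => (hb z).hasSum
      exact ⟨⟨_, isHardy_iff.2 ⟨h1, by rw [h2]; exact memlp_iff.1 c.2⟩⟩, Subtype.ext h2⟩)

/-- The Hardy–Hilbert space `H²`. It is a type of its own, so that its topology is the one of the
norm below, not the topology of pointwise convergence. -/
def H2 : Type := hardySubmodule

namespace H2

instance : CoeFun H2 (fun _ => 𝔻 → ℂ) := ⟨Subtype.val⟩

/-- The element of `H²` given by a function. -/
def of (f : 𝔻 → ℂ) (hf : IsHardy f) : H2 := ⟨f, hf⟩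

/-- The `H²` norm is the `ℓ²` norm of the Maclaurin coefficients; see `isLUB_mean2`. -/
instance : NormedAddCommGroup H2 :=
  NormedAddCommGroup.induced hardySubmodule (lp (fun _ : ℕ => ℂ) 2) hardyEquiv.toLinearMap
    hardyEquiv.injective

/-- The inner product of `H²`. As in Mathlib it is linear in the second variable. -/
instance : InnerProductSpace ℂ H2 where
  toModule := inferInstanceAs (Module ℂ hardySubmodule)
  inner f g := ∑' n, taylorCoeff g n * conj (taylorCoeff f n)
  norm_smul_le c f := (congrArg norm (hardyEquiv.map_smul c f)).trans_le (norm_smul_le _ _)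
  norm_sq_eq_re_inner f := norm_sq_eq_re_inner (𝕜 := ℂ) (hardyEquiv f)
  conj_inner_symm f g := inner_conj_symm (hardyEquiv f) (hardyEquiv g)
  add_left f g h :=
    (congrArg (fun x => inner ℂ x (hardyEquiv h)) (hardyEquiv.map_add f g)).trans
      (inner_add_left (hardyEquiv f) (hardyEquiv g) (hardyEquiv h))
  smul_left f g c :=
    (congrArg (fun x => inner ℂ x (hardyEquiv g)) (hardyEquiv.map_smul c f)).trans
      (inner_smul_left (hardyEquiv f) (hardyEquiv g) c)

theorem isHardy (f : H2) : IsHardy (f : 𝔻 → ℂ) := f.2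

theorem coe_of (f : 𝔻 → ℂ) (hf : IsHardy f) : (of f hf : 𝔻 → ℂ) = f := rfl
theorem coe_add (f g : H2) : ((f + g : H2) : 𝔻 → ℂ) = (f : 𝔻 → ℂ) + g := rfl
theorem coe_smul (c : ℂ) (f : H2) : ((c • f : H2) : 𝔻 → ℂ) = c • (f : 𝔻 → ℂ) := rfl
theorem ext' {f g : H2} (h : (f : 𝔻 → ℂ) = g) : f = g := Subtype.ext h

/-- The identification of `H²` with `ℓ²` through the Maclaurin coefficients, as an isometry. -/
def toLp : H2 ≃ₗᵢ[ℂ] lp (fun _ : ℕ => ℂ) 2 where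
  toFun f := hardyEquiv f
  invFun c := hardyEquiv.symm c
  left_inv f := hardyEquiv.symm_apply_apply f
  right_inv c := hardyEquiv.apply_symm_apply c
  map_add' f g := hardyEquiv.map_add f g
  map_smul' c f := hardyEquiv.map_smul c f
  norm_map' _ := rfl

theorem toLp_apply (f : H2) (n : ℕ) : toLp f n = taylorCoeff f n := rfl

theorem inner_eq (f g : H2) : inner ℂ f g = ∑' n, taylorCoeff g n * conj (taylorCoeff f n) := rfl

instance : CompleteSpace H2 :=
  (completeSpace_congr (e := toLp.toEquiv) toLp.isometry.isUniformEmbedding).2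
    inferInstance

theorem norm_sq_eq (f : H2) : ‖f‖ ^ 2 = ∑' n, ‖taylorCoeff f n‖ ^ 2 := by
  have h := lp.norm_rpow_eq_tsum (p := 2) (by norm_num) (toLp f)
  simpa [toLp_apply] using h

/-- The norm of `H²` is the supremum of the integral means. -/
theorem isLUB_mean2 (f : H2) : IsLUB (mean2 f '' Set.Ico 0 1) (‖f‖ ^ 2) := by
  have hf := isHardy_iff.1 (isHardy f)
  rw [norm_sq_eq]
  refine ⟨?_, fun M hM => (summable_of_mean2 hf.1 fun r h0 h1 => hM ⟨r, ⟨h0, h1⟩, rfl⟩).2⟩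
  rintro _ ⟨r, hr, rfl⟩
  exact mean2_le hf.1 hf.2 hr.1 hr.2

end H2

/-- `H^∞`: bounded holomorphic functions on the unit disc. -/
def HInfty : Set (𝔻 → ℂ) := {f | IsHol f ∧ ∃ C : ℝ, ∀ z, ‖f z‖ ≤ C}

theorem zeroExt_mul (f g : 𝔻 → ℂ) : zeroExt (f * g) = zeroExt f * zeroExt g := by
  ext z
  by_cases h : ‖z‖ < 1 <;> simp [zeroExt, h]

theorem IsHol.mul {f g : 𝔻 → ℂ} (hf : IsHol f) (hg : IsHol g) : IsHol (f * g) := by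
  unfold IsHol
  rw [zeroExt_mul]
  exact DifferentiableOn.mul hf hg

theorem IsHol.circleIntegrable {f : 𝔻 → ℂ} (hf : IsHol f) {r : ℝ} (h0 : 0 ≤ r) (h1 : r < 1) :
    CircleIntegrable (fun z => ‖zeroExt f z‖ ^ 2) 0 r := by
  refine ContinuousOn.circleIntegrable h0 (ContinuousOn.pow (ContinuousOn.norm ?_) 2)
  exact hf.continuousOn.mono (Metric.sphere_subset_closedBall.trans
    (Metric.closedBall_subset_ball h1))

theorem mean2_mul_le {b f : 𝔻 → ℂ} (hb : IsHol b) (hf : IsHol f) {C : ℝ}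
    (hC : ∀ z, ‖b z‖ ≤ C) {r : ℝ} (h0 : 0 ≤ r) (h1 : r < 1) :
    mean2 (b * f) r ≤ C ^ 2 * mean2 f r := by
  have h := Real.circleAverage_mono ((hb.mul hf).circleIntegrable h0 h1)
    ((hf.circleIntegrable h0 h1).const_smul (a := C ^ 2)) ?_
  · rw [Real.circleAverage_smul] at h
    exact h
  · intro z hz
    have hz' : ‖z‖ < 1 := by simpa [abs_of_nonneg h0] using (by simpa using hz : ‖z‖ = |r|).trans_lt (by simpa [abs_of_nonneg h0] using h1)
    simp only [zeroExt_mul, Pi.mul_apply, norm_mul, mul_pow, Pi.smul_apply, smul_eq_mul]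
    gcongr
    rw [zeroExt_mk _ hz']
    exact hC _

theorem IsHardy.mul {b f : 𝔻 → ℂ} (hb : b ∈ HInfty) (hf : IsHardy f) : IsHardy (b * f) := by
  obtain ⟨hb, C, hC⟩ := hb
  obtain ⟨hf, M, hM⟩ := hf
  refine ⟨hb.mul hf, C ^ 2 * M, fun r h0 h1 => (mean2_mul_le hb hf hC h0 h1).trans ?_⟩
  exact mul_le_mul_of_nonneg_left (hM r h0 h1) (sq_nonneg C)

/-- The Toeplitz operator `T_b` of a symbol `b ∈ H^∞`: multiplication by `b` on `H²`. -/
def toeplitz (b : 𝔻 → ℂ) (hb : b ∈ HInfty) : H2 →L[ℂ] H2 :=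
  LinearMap.mkContinuousOfExistsBound
    { toFun := fun f => H2.of (b * f) (IsHardy.mul hb (H2.isHardy f))
      map_add' := fun f g => H2.ext' (mul_add b (f : 𝔻 → ℂ) g)
      map_smul' := fun c f => H2.ext' (mul_smul_comm c b (f : 𝔻 → ℂ)) }
    (by
      obtain ⟨hb', C, hC⟩ := id hb
      have hC0 : 0 ≤ C := (norm_nonneg _).trans (hC 0)
      refine ⟨C, fun f => ?_⟩
      refine le_of_sq_le_sq ?_ (by positivity)
      refine (H2.isLUB_mean2 _).2 ?_
      rintro _ ⟨r, hr, rfl⟩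
      refine (mean2_mul_le hb' (H2.isHardy f).1 hC hr.1 hr.2).trans ?_
      rw [mul_pow]
      gcongr
      exact (H2.isLUB_mean2 f).1 ⟨r, hr, rfl⟩)

theorem toeplitz_apply (b : 𝔻 → ℂ) (hb : b ∈ HInfty) (f : H2) (z : 𝔻) :
    toeplitz b hb f z = b z * f z := rfl

/-- `h_k(z) = (1 / (1 - z)) log ((1 + z + ⋯ + z^{k-1}) / k)`. On the disc `(1 + ⋯ + z^{k-1}) / k` is
never a non-positive real number (see `log_quotient`), so the principal logarithm is the holomorphic
branch. -/
def hFun (k : ℕ) (z : 𝔻) : ℂ :=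
  1 / (1 - (z : ℂ)) * Complex.log ((∑ i ∈ Finset.range k, (z : ℂ) ^ i) / k)

/-- The Maclaurin coefficients of `h_k`. -/
def hCoeff (k n : ℕ) : ℝ := harmonic n - harmonic (n / k) - Real.log k

theorem harmonic_bounds {n : ℕ} (hn : 1 ≤ n) :
    Real.eulerMascheroniConstant + Real.log n ≤ harmonic n ∧
      (harmonic n : ℝ) ≤ Real.eulerMascheroniConstant + Real.log (n + 1) := by
  have h1 := Real.eulerMascheroniSeq_lt_eulerMascheroniConstant n
  have h2 := Real.eulerMascheroniConstant_lt_eulerMascheroniSeq' n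
  rw [Real.eulerMascheroniSeq] at h1
  rw [Real.eulerMascheroniSeq', if_neg (by omega)] at h2
  constructor <;> linarith

theorem abs_hCoeff_le {k n : ℕ} (hk : 1 ≤ k) (hn : k ≤ n) : |hCoeff k n| ≤ 2 * k / n := by
  have hM : 1 ≤ n / k := (Nat.one_le_div_iff (by omega)).2 hn
  obtain ⟨a1, a2⟩ := harmonic_bounds (hk.trans hn)
  obtain ⟨b1, b2⟩ := harmonic_bounds hM
  have c1 : (k : ℝ) * (n / k : ℕ) ≤ n := by exact_mod_cast Nat.mul_div_le n k
  have c2 : (n : ℝ) + 1 ≤ k * ((n / k : ℕ) + 1) := by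
    exact_mod_cast Nat.lt_mul_div_succ n (by omega)
  unfold hCoeff
  set M : ℝ := ((n / k : ℕ) : ℝ) with hMdef
  have hk' : (1 : ℝ) ≤ k := by exact_mod_cast hk
  have hM' : (1 : ℝ) ≤ M := by rw [hMdef]; exact_mod_cast hM
  have hn' : (1 : ℝ) ≤ n := by exact_mod_cast hk.trans hn
  have u : Real.log (n + 1) - Real.log M - Real.log k ≤ 2 * k / n := by
    have e : Real.log (n + 1) - Real.log M - Real.log k = Real.log ((n + 1) / (k * M)) := by
      rw [Real.log_div (by positivity) (by positivity), Real.log_mul (by positivity) (by positivity)]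
      ring
    rw [e]
    refine (Real.log_le_sub_one_of_pos (by positivity)).trans ?_
    rw [sub_le_iff_le_add, div_le_iff₀ (by positivity), add_mul, div_mul_eq_mul_div, one_mul]
    have : (k : ℝ) ≤ 2 * k * (k * M) / n := by
      rw [le_div_iff₀ (by positivity)]
      have : (n : ℝ) ≤ 2 * (k * M) := by nlinarith
      nlinarith
    linarith
  have l : Real.log (M + 1) + Real.log k - Real.log n ≤ 2 * k / n := by
    have e : Real.log (M + 1) + Real.log k - Real.log n = Real.log (((M + 1) * k) / n) := by
      rw [Real.log_div (by positivity) (by positivity), Real.log_mul (by positivity) (by positivity)]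
    rw [e]
    refine (Real.log_le_sub_one_of_pos (by positivity)).trans ?_
    rw [sub_le_iff_le_add, div_le_iff₀ (by positivity), add_mul (2 * (k : ℝ) / n) 1,
      div_mul_cancel₀ _ (show (n : ℝ) ≠ 0 by positivity)]
    nlinarith
  rw [abs_le]
  constructor <;> linarith

theorem summable_hCoeff {k : ℕ} (hk : 1 ≤ k) : Summable fun n => ‖(hCoeff k n : ℂ)‖ ^ 2 := by
  have hs : Summable fun n : ℕ => (2 * (k : ℝ)) ^ 2 * (1 / (n : ℝ) ^ 2) :=
    (Real.summable_one_div_nat_pow.2 (by norm_num)).mul_left _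
  refine Summable.of_norm_bounded_eventually_nat hs ?_
  filter_upwards [eventually_ge_atTop k] with n hn
  have h := abs_hCoeff_le hk hn
  rw [Complex.norm_real, Real.norm_eq_abs, Real.norm_eq_abs, abs_of_nonneg (by positivity)]
  calc |hCoeff k n| ^ 2 ≤ (2 * k / n) ^ 2 := by gcongr
    _ = _ := by ring

theorem hCoeff_succ (k n : ℕ) :
    hCoeff k (n + 1) - hCoeff k n =
      1 / ((n + 1 : ℕ) : ℝ) - if k ∣ n + 1 then 1 / (((n + 1) / k : ℕ) : ℝ) else 0 := by
  unfold hCoeff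
  rw [Nat.succ_div, harmonic_succ]
  split_ifs with h
  · rw [harmonic_succ]; push_cast; ring
  · push_cast; simp

theorem log_quotient {k : ℕ} (hk : 1 ≤ k) (z : 𝔻) :
    Complex.log ((∑ i ∈ Finset.range k, (z : ℂ) ^ i) / k) =
      Complex.log (1 - (z : ℂ) ^ k) - Complex.log (1 - z) - (Real.log k : ℂ) := by
  have hre : ∀ w : ℂ, ‖w‖ < 1 → 0 < (1 - w).re := by
    intro w hw
    have := (Complex.abs_re_le_norm w).trans_lt hw
    rw [Complex.sub_re, Complex.one_re]
    linarith [(abs_lt.1 this).2]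
  have hzk : ‖(z : ℂ) ^ k‖ < 1 := by
    rw [norm_pow]
    exact pow_lt_one₀ (norm_nonneg _) z.norm_lt_one (by omega)
  have h1 := hre _ z.norm_lt_one
  have h2 := hre _ hzk
  have n1 : (1 - (z : ℂ)) ≠ 0 := fun h => by rw [h] at h1; simp at h1
  have n2 : (1 - (z : ℂ) ^ k) ≠ 0 := fun h => by rw [h] at h2; simp at h2
  have a1 := abs_lt.1 (Complex.abs_arg_lt_pi_div_two_iff.2 (Or.inl h1))
  have a2 := abs_lt.1 (Complex.abs_arg_lt_pi_div_two_iff.2 (Or.inl h2))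
  have hkC : (k : ℂ) ≠ 0 := by exact_mod_cast (by omega : k ≠ 0)
  have e : (∑ i ∈ Finset.range k, (z : ℂ) ^ i) / k =
      exp (Complex.log (1 - (z : ℂ) ^ k) - Complex.log (1 - z) - (Real.log k : ℂ)) := by
    rw [Complex.exp_sub, Complex.exp_sub, Complex.exp_log n1, Complex.exp_log n2,
      ← Complex.ofReal_exp, Real.exp_log (by exact_mod_cast hk), Complex.ofReal_natCast]
    congr 1
    rw [eq_div_iff n1, mul_comm, mul_neg_geom_sum]
  rw [e, Complex.log_exp]
  · simp only [Complex.sub_im, Complex.log_im, Complex.ofReal_im]; linarith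
  · simp only [Complex.sub_im, Complex.log_im, Complex.ofReal_im]; linarith

theorem hasSum_hFun {k : ℕ} (hk : 1 ≤ k) (z : 𝔻) :
    HasSum (fun n => (hCoeff k n : ℂ) * (z : ℂ) ^ n) (hFun k z) := by
  have hz := z.norm_lt_one
  have hzk : ‖(z : ℂ) ^ k‖ < 1 := by
    rw [norm_pow]
    exact pow_lt_one₀ (norm_nonneg _) hz (by omega)
  have n1 : (1 - (z : ℂ)) ≠ 0 := fun h => z.coe_ne_one (sub_eq_zero.1 h).symm
  have hinj : Function.Injective fun m : ℕ => k * m := fun a b h =>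
    Nat.eq_of_mul_eq_mul_left (by omega) h
  have s1 := Complex.hasSum_taylorSeries_neg_log hz
  have s2 : HasSum (fun n : ℕ => if k ∣ n then (z : ℂ) ^ n / ((n / k : ℕ) : ℂ) else 0)
      (-Complex.log (1 - (z : ℂ) ^ k)) := by
    rw [← hinj.hasSum_iff]
    · convert Complex.hasSum_taylorSeries_neg_log hzk using 2 with m
      simp [Nat.mul_div_cancel_left m (show 0 < k by omega), pow_mul]
    · intro n hn
      rw [if_neg]
      rintro ⟨m, rfl⟩
      exact hn ⟨m, rfl⟩
  have s3 : HasSum (fun n : ℕ => (z : ℂ) ^ (n + 1) / ((n + 1 : ℕ) : ℂ) -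
      if k ∣ n + 1 then (z : ℂ) ^ (n + 1) / (((n + 1) / k : ℕ) : ℂ) else 0)
      (-Complex.log (1 - z) - -Complex.log (1 - (z : ℂ) ^ k)) := by
    simpa using (hasSum_nat_add_iff' 1).2 (s1.sub s2)
  have hsum : Summable fun n => (hCoeff k n : ℂ) * (z : ℂ) ^ n := by
    have hb : ∀ᶠ n in atTop, ‖(hCoeff k n : ℂ)‖ ^ 2 < 1 :=
      (summable_hCoeff hk).tendsto_atTop_zero.eventually_lt_const one_pos
    refine Summable.of_norm_bounded_eventually_nat
      (summable_geometric_of_lt_one (norm_nonneg _) hz) ?_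
    filter_upwards [hb] with n hn
    rw [norm_mul, norm_pow]
    refine mul_le_of_le_one_left (by positivity) ?_
    nlinarith [norm_nonneg (hCoeff k n : ℂ)]
  obtain ⟨S, hS⟩ := hsum
  have t1 := (hasSum_nat_add_iff' 1).2 hS
  have t2 := t1.sub (hS.mul_left (z : ℂ))
  have step : ∀ n : ℕ, (hCoeff k (n + 1) : ℂ) * (z : ℂ) ^ (n + 1) - z * (hCoeff k n * (z : ℂ) ^ n) =
      (z : ℂ) ^ (n + 1) / ((n + 1 : ℕ) : ℂ) -
        if k ∣ n + 1 then (z : ℂ) ^ (n + 1) / (((n + 1) / k : ℕ) : ℂ) else 0 := by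
    intro n
    have e : (hCoeff k (n + 1) : ℂ) * (z : ℂ) ^ (n + 1) - z * (hCoeff k n * (z : ℂ) ^ n) =
      ((hCoeff k (n + 1) - hCoeff k n : ℝ) : ℂ) * (z : ℂ) ^ (n + 1) := by push_cast; ring
    rw [e, hCoeff_succ k n]
    split_ifs <;> push_cast <;> ring
  simp only [step] at t2
  have key := t2.unique s3
  have h0 : hCoeff k 0 = -Real.log k := by simp [hCoeff]
  have : S = hFun k z := by
    rw [hFun, log_quotient hk, div_mul_eq_mul_div, one_mul, eq_div_iff n1]
    simp [h0] at key
    push_cast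
    linear_combination key
  rwa [← this]

theorem hFun_isHardy {k : ℕ} (hk : 1 ≤ k) : IsHardy (hFun k) := by
  obtain ⟨h1, h2⟩ := coeff_unique (hasSum_hFun hk)
  refine isHardy_iff.2 ⟨h1, ?_⟩
  rw [h2]
  exact summable_hCoeff hk

/-- `h_k`, for `k ≥ 2`, as an element of `H²`. -/
def hVec (k : {k : ℕ // 2 ≤ k}) : H2 := H2.of (hFun k) (hFun_isHardy (one_le_two.trans k.2))

/-- `𝒩`, the linear span of `{h_k : k ≥ 2}` in `H²`. -/
def spanH : Submodule ℂ H2 := Submodule.span ℂ (Set.range hVec)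

theorem coord_mem_HInfty : (fun z : 𝔻 => (z : ℂ)) ∈ HInfty := by
  refine ⟨?_, 1, fun z => z.norm_lt_one.le⟩
  refine (coeff_unique (c := fun n => if n = 1 then 1 else 0) fun z => ?_).1
  convert hasSum_ite_eq 1 (z : ℂ) using 2 with n
  by_cases h : n = 1 <;> simp [h]

/-- The shift `(S f)(z) = z f(z)` on `H²`. -/
def shift : H2 →L[ℂ] H2 := toeplitz (fun z => (z : ℂ)) coord_mem_HInfty

/-- `h` is outer: it belongs to `H²` and is a cyclic vector for the shift on `H²`. -/
def IsOuter (h : 𝔻 → ℂ) : Prop :=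
  ∃ hh : IsHardy h,
    (Submodule.span ℂ (Set.range fun n : ℕ => (shift ^ n) (H2.of h hh))).topologicalClosure = ⊤

/-- The Smirnov class `N⁺`: quotients `g / h` with `g, h ∈ H^∞` and `h` outer (in particular `h` has
no zeros in the disc). -/
def Smirnov : Set (𝔻 → ℂ) :=
  {φ | ∃ g ∈ HInfty, ∃ h ∈ HInfty, IsOuter h ∧ ∀ z, φ z = g z / h z}

/-- `φ` is a unit of the algebra `N⁺`. -/
def IsSmirnovUnit (φ : 𝔻 → ℂ) : Prop :=
  φ ∈ Smirnov ∧ ∃ ψ ∈ Smirnov, ∀ z, φ z * ψ z = 1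

/-- `f` has the radial limit `w` at the boundary point `e^{iθ}`. -/
def HasRadialLimit (f : 𝔻 → ℂ) (θ : ℝ) (w : ℂ) : Prop :=
  Tendsto (fun r : ℝ => zeroExt f (r * exp (θ * I))) (𝓝[<] 1) (𝓝 w)

/-- `(b, a)` is a Pythagorean pair: `b` is in the closed unit ball of `H^∞`, `a ∈ H^∞` is outer,
`a(0) > 0`, and the radial limits satisfy `|a^*|² + |b^*|² = 1` almost everywhere on the circle. -/
structure IsPythagoreanPair (b a : 𝔻 → ℂ) : Prop where
  b_mem : b ∈ HInfty
  b_le : ∀ z, ‖b z‖ ≤ 1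
  a_mem : a ∈ HInfty
  a_outer : IsOuter a
  a_zero : ∃ c : ℝ, 0 < c ∧ a 0 = c
  ae_eq_one : ∀ᵐ θ : ℝ, ∃ u v : ℂ,
    HasRadialLimit a θ u ∧ HasRadialLimit b θ v ∧ ‖u‖ ^ 2 + ‖v‖ ^ 2 = 1

/-- The de Branges–Rovnyak space `ℋ(b)`, the range of `(I - T_b T_b^*)^{1/2}` on `H²`, for `b` in the
closed unit ball of `H^∞`. -/
def deBrangesRovnyak (b : 𝔻 → ℂ) (hb : b ∈ HInfty) : Submodule ℂ H2 :=
  LinearMap.range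
    (CFC.sqrt (1 - toeplitz b hb ∘L ContinuousLinearMap.adjoint (toeplitz b hb)) :
      H2 →L[ℂ] H2).toLinearMap

/-- A family of functions is complete in `H²`: all its members belong to `H²` and their linear span is
dense in `H²`. -/
def IsCompleteInH2 {ι : Type*} (f : ι → 𝔻 → ℂ) : Prop :=
  ∃ hf : ∀ i, IsHardy (f i),
    (Submodule.span ℂ (Set.range fun i => H2.of (f i) (hf i))).topologicalClosure = ⊤

end

end HardyDisc

open HardyDisc
open scoped Complex.UnitDisc

/-!
Write `D = (I - T_b T_b^*)^{1/2}` and let `f = D u` be orthogonal to every `h_k`. It suffices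
that `⟨b q, f⟩ = 0` for all `q` in `H²`: as `b` times a suitable bounded function is a product of two
bounded outer functions, `T_b` has dense range (`denseRange_toeplitz_of_unit`), so then `f = 0`.

Since `|a|² + |b|² = 1` on the circle, `‖g‖² ≤ ‖a g‖² + ‖b g‖²` for `g` in `H²` (`norm_sq_le`). It
follows that `‖D T_b g‖ ≤ ‖a g‖`, whence `|⟨b g, f⟩| ≤ ‖u‖ ‖a g‖`
(`exists_bound_of_mem_deBrangesRovnyak`). If `h_k / φ = a g_k` and `h_k = b g_k` with `g_k` in `H²`, then
`⟨b p, f⟩ = 0` for `p` in the span of the `g_k`, while the functions `a p` are dense by completeness of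
`(h_k / φ)`; the bound then carries the vanishing over to all `q`.

What remains is the existence of `g_k`, that is, that multiplication by `φ = b / a` has domain `a H²`
(`exists_eq_pairToeplitz`). This is proved without boundary factorization theory. The space `K` of pairs
`(x, y)` in `H² ⊕ H²` with `b x = a y` is closed and invariant under the shift, and a pair in `K` with
`x(0) = 0` is divisible by the coordinate within `K`. As in Beurling's theorem, `K` is therefore the
isometric image of `H²` under `f ↦ f w` for a wandering vector `w`
(`exists_isometry_onto_quotientGraph`). The set of `f` for which `f w` has the form `(a g, b g)` is closed
because `g ↦ (a g, b g)` is bounded below, it is shift invariant, and it contains `a` because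
`a w = (a x, b x)` for `w = (x, y)`. As `a` is cyclic, it is all of `H²`.
-/

namespace HardyDisc

open MeasureTheory Filter Topology
open scoped ComplexConjugate Real

/-! ### Point evaluations, monomials and the shift -/

theorem coeff_one :
    IsHol (fun _ => 1) ∧ taylorCoeff (fun _ => 1) = fun n => if n = 0 then 1 else 0 := by
  refine coeff_unique fun z => ?_
  convert hasSum_ite_eq 0 (1 : ℂ) using 2 with n
  split_ifs with h <;> simp [h]

theorem isHardy_one : IsHardy fun _ => 1 := by
  refine isHardy_iff.2 ⟨coeff_one.1, ?_⟩
  rw [coeff_one.2]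
  refine summable_of_ne_finset_zero (s := {0}) fun n hn => ?_
  simpa using hn

/-- The constant function `1` in `H²`. -/
noncomputable def H2.one : H2 := H2.of (fun _ => 1) isHardy_one

theorem H2.hasSum (f : H2) (z : 𝔻) : HasSum (fun n => taylorCoeff f n * (z : ℂ) ^ n) (f z) := by
  simpa [zeroExt_coe] using hasSum_coeff f.isHardy.1 z.norm_lt_one

theorem H2.taylorCoeff_zero (f : H2) : taylorCoeff f 0 = f 0 := by
  have h := zeroExt_coe f 0
  rw [Complex.UnitDisc.coe_zero] at h
  simp [taylorCoeff, h]

theorem H2.eq_zero_of_taylorCoeff {f : H2} (h : ∀ n, taylorCoeff f n = 0) : f = 0 := by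
  have : H2.toLp f = 0 := by
    ext n
    simpa [H2.toLp_apply] using h n
  simpa using this

/-- Point evaluations are continuous on `H²`: evaluation at `z` is the inner product with the Szegő
kernel `w ↦ (1 - conj z * w)⁻¹`. -/
theorem H2.exists_inner_eq_apply (z : 𝔻) : ∃ k : H2, ∀ f : H2, inner ℂ k f = f z := by
  have hk : Memℓp (fun n => conj (z : ℂ) ^ n) 2 := by
    rw [memlp_iff]
    have := summable_geometric_of_lt_one (by positivity : 0 ≤ ‖(z : ℂ)‖ ^ 2)
      (pow_lt_one₀ (norm_nonneg _) z.norm_lt_one two_ne_zero)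
    refine this.congr fun n => ?_
    simp [← pow_mul, mul_comm]
  refine ⟨H2.toLp.symm ⟨_, hk⟩, fun f => ?_⟩
  rw [H2.inner_eq, ← (H2.hasSum f z).tsum_eq]
  refine tsum_congr fun n => ?_
  rw [← H2.toLp_apply (H2.toLp.symm _), LinearIsometryEquiv.apply_symm_apply]
  simp

theorem shift_apply (f : H2) (z : 𝔻) : shift f z = z * f z := rfl

theorem taylorCoeff_shift (f : H2) :
    taylorCoeff (shift f) 0 = 0 ∧ ∀ n, taylorCoeff (shift f) (n + 1) = taylorCoeff f n := by
  have h := (coeff_unique (f := (shift f : 𝔻 → ℂ))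
    (c := fun n => n.casesOn 0 fun m => taylorCoeff f m) fun z => ?_).2
  · rw [h]
    exact ⟨rfl, fun _ => rfl⟩
  · rw [← hasSum_nat_add_iff' 1]
    simpa [shift_apply, pow_succ', mul_left_comm] using (H2.hasSum f z).mul_left (z : ℂ)

theorem inner_shift_shift (f g : H2) : inner ℂ (shift f) (shift g) = inner ℂ f g := by
  rw [H2.inner_eq, H2.inner_eq]
  have hs : Summable fun n => taylorCoeff (shift g) n * conj (taylorCoeff (shift f) n) := by
    simpa [H2.toLp_apply, mul_comm] using
      lp.summable_inner (𝕜 := ℂ) (H2.toLp (shift f)) (H2.toLp (shift g))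
  rw [hs.tsum_eq_zero_add]
  simp [taylorCoeff_shift]

/-- A function in `H²` vanishing at the origin is divisible by the coordinate. -/
theorem exists_eq_shift {f : H2} (hf : f 0 = 0) : ∃ g, f = shift g := by
  have hm : Memℓp (fun n => taylorCoeff f (n + 1)) 2 :=
    memlp_iff.2 ((summable_nat_add_iff 1).2 (isHardy_iff.1 f.isHardy).2)
  refine ⟨H2.toLp.symm ⟨_, hm⟩, ?_⟩
  rw [← sub_eq_zero]
  refine H2.eq_zero_of_taylorCoeff fun n => ?_
  rw [← H2.toLp_apply, map_sub, lp.coeFn_sub, Pi.sub_apply, H2.toLp_apply, H2.toLp_apply, sub_eq_zero]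
  rcases n with _ | n
  · rw [H2.taylorCoeff_zero, hf, (taylorCoeff_shift _).1]
  · rw [(taylorCoeff_shift _).2, ← H2.toLp_apply (H2.toLp.symm _),
      LinearIsometryEquiv.apply_symm_apply]

theorem shift_pow_succ_apply (n : ℕ) (f : H2) : (shift ^ (n + 1)) f = shift ((shift ^ n) f) := by
  rw [pow_succ']
  rfl

theorem shift_pow_one_apply (n : ℕ) (z : 𝔻) : (shift ^ n) H2.one z = (z : ℂ) ^ n := by
  induction n with
  | zero => rfl
  | succ n ih => rw [shift_pow_succ_apply, shift_apply, ih, pow_succ']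

theorem taylorCoeff_shift_pow_one (n m : ℕ) :
    taylorCoeff ((shift ^ n) H2.one) m = if m = n then 1 else 0 := by
  refine congrFun (coeff_unique (c := fun m => if m = n then 1 else 0) fun z => ?_).2 m
  rw [shift_pow_one_apply]
  convert hasSum_ite_eq n ((z : ℂ) ^ n) using 2 with m
  split_ifs with h <;> simp [h]

theorem inner_shift_pow_one (n : ℕ) (f : H2) :
    inner ℂ ((shift ^ n) H2.one) f = taylorCoeff f n := by
  rw [H2.inner_eq, tsum_eq_single n]
  · rw [taylorCoeff_shift_pow_one, if_pos rfl, map_one, mul_one]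
  · intro m hm
    rw [taylorCoeff_shift_pow_one, if_neg hm, map_zero, mul_zero]

theorem dense_span_monomials :
    Dense (Submodule.span ℂ (Set.range fun n : ℕ => (shift ^ n) H2.one) : Set H2) := by
  rw [Submodule.dense_iff_topologicalClosure_eq_top, Submodule.topologicalClosure_eq_top_iff,
    Submodule.eq_bot_iff]
  intro f hf
  refine H2.eq_zero_of_taylorCoeff fun n => ?_
  rw [← inner_shift_pow_one]
  exact hf _ (Submodule.subset_span ⟨n, rfl⟩)

theorem toeplitz_shift (b : 𝔻 → ℂ) (hb : b ∈ HInfty) (f : H2) :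
    toeplitz b hb (shift f) = shift (toeplitz b hb f) :=
  H2.ext' (funext fun z => mul_left_comm (b z) (z : ℂ) (f z))

/-- A bounded outer function has a multiplication operator with dense range. -/
theorem denseRange_toeplitz {h : 𝔻 → ℂ} (hh : h ∈ HInfty) (ho : IsOuter h) :
    DenseRange (toeplitz h hh) := by
  obtain ⟨h', hc⟩ := ho
  rw [← Submodule.dense_iff_topologicalClosure_eq_top] at hc
  refine hc.mono ?_
  change _ ≤ ((toeplitz h hh).range : Submodule ℂ H2)
  rw [Submodule.span_le]
  rintro _ ⟨n, rfl⟩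
  refine ⟨(shift ^ n) H2.one, ?_⟩
  induction n with
  | zero => exact H2.ext' (funext fun z => mul_one (h z))
  | succ n ih =>
    simp only [ContinuousLinearMap.coe_coe] at ih ⊢
    rw [shift_pow_succ_apply, toeplitz_shift, ih, shift_pow_succ_apply]

theorem norm_toeplitz_apply_le {b : 𝔻 → ℂ} (hb : b ∈ HInfty) (h1 : ∀ z, ‖b z‖ ≤ 1) (f : H2) :
    ‖toeplitz b hb f‖ ≤ ‖f‖ := by
  refine le_of_sq_le_sq ((H2.isLUB_mean2 _).2 ?_) (norm_nonneg _)
  rintro _ ⟨r, hr, rfl⟩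
  refine (mean2_mul_le hb.1 f.isHardy.1 h1 hr.1 hr.2).trans ?_
  simpa using (H2.isLUB_mean2 f).1 ⟨r, hr, rfl⟩

/-! ### The Pythagorean identity as a norm inequality -/

theorem monotone_mean2 {f : 𝔻 → ℂ} (hf : IsHol f) {r s : ℝ} (h0 : 0 ≤ r) (hrs : r ≤ s)
    (h1 : s < 1) : mean2 f r ≤ mean2 f s :=
  hasSum_le (fun n => by gcongr) (hasSum_mean2 hf h0 (hrs.trans_lt h1))
    (hasSum_mean2 hf (h0.trans hrs) h1)

/-- For bounded `g` the integral means of `|g|² (1 - |a|² - |b|²)` over the circles of radius `r`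
tend to `0`, by dominated convergence; no boundary values of `g` are involved. -/
theorem norm_sq_le_of_bounded {b a : 𝔻 → ℂ} (hba : IsPythagoreanPair b a) (g : H2) {C : ℝ}
    (hC : ∀ z, ‖g z‖ ≤ C) :
    ‖g‖ ^ 2 ≤ ‖toeplitz a hba.a_mem g‖ ^ 2 + ‖toeplitz b hba.b_mem g‖ ^ 2 := by
  obtain ⟨A, hA⟩ := hba.a_mem.2
  have hg := g.isHardy.1
  have hag := (toeplitz a hba.a_mem g).isHardy.1
  have hbg := (toeplitz b hba.b_mem g).isHardy.1
  set G := zeroExt g with hG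
  set α := zeroExt a
  set β := zeroExt b
  have bd : ∀ (f : 𝔻 → ℂ) (M : ℝ), (∀ z, ‖f z‖ ≤ M) → ∀ z, ‖zeroExt f z‖ ≤ M := by
    intro f M hM z
    by_cases hz : ‖z‖ < 1
    · rw [zeroExt_mk f hz]; exact hM _
    · simpa [zeroExt, hz] using (norm_nonneg _).trans (hM 0)
  have cont : ∀ {f : 𝔻 → ℂ}, IsHol f → ∀ {r : ℝ}, r ∈ Set.Ioo (0 : ℝ) 1 →
      Continuous fun θ => zeroExt f (circleMap 0 r θ) := by
    intro f hf r hr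
    refine (hf.continuousOn).comp_continuous (continuous_circleMap 0 r) fun θ => ?_
    simpa [abs_of_pos hr.1] using hr.2
  have lim : Tendsto (fun r : ℝ => mean2 g r -
      (mean2 (toeplitz a hba.a_mem g) r + mean2 (toeplitz b hba.b_mem g) r)) (𝓝[<] 1) (𝓝 0) := by
    have key : Tendsto (fun r : ℝ => ∫ θ in (0 : ℝ)..2 * π, ‖G (circleMap 0 r θ)‖ ^ 2 *
        (1 - ‖α (circleMap 0 r θ)‖ ^ 2 - ‖β (circleMap 0 r θ)‖ ^ 2)) (𝓝[<] 1)
        (𝓝 (∫ _θ in (0 : ℝ)..2 * π, (0 : ℝ))) := by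
      refine intervalIntegral.tendsto_integral_filter_of_dominated_convergence
        (fun _ => C ^ 2 * (1 + A ^ 2 + 1)) ?_ ?_ intervalIntegrable_const ?_
      · filter_upwards [Ioo_mem_nhdsLT (show (0 : ℝ) < 1 by norm_num)] with r hr
        have c1 := cont hg hr
        have c2 := cont hba.a_mem.1 hr
        have c3 := cont hba.b_mem.1 hr
        exact ((c1.norm.pow 2).mul ((continuous_const.sub (c2.norm.pow 2)).sub
          (c3.norm.pow 2))).aestronglyMeasurable
      · refine Eventually.of_forall fun r => Eventually.of_forall fun θ _ => ?_
        have h1 := bd _ _ hC (circleMap 0 r θ)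
        have h2 := bd _ _ hA (circleMap 0 r θ)
        have h3 := bd _ _ hba.b_le (circleMap 0 r θ)
        rw [norm_mul, norm_pow, norm_norm]
        gcongr
        have h2' := pow_le_pow_left₀ (norm_nonneg _) h2 2
        have h3' := pow_le_pow_left₀ (norm_nonneg _) h3 2
        rw [Real.norm_eq_abs, abs_le]
        constructor <;> nlinarith [sq_nonneg ‖α (circleMap 0 r θ)‖, sq_nonneg ‖β (circleMap 0 r θ)‖]
      · filter_upwards [hba.ae_eq_one] with θ hθ _
        obtain ⟨u, v, hu, hv, huv⟩ := hθ
        have e : Tendsto (fun r : ℝ => 1 - ‖α (circleMap 0 r θ)‖ ^ 2 - ‖β (circleMap 0 r θ)‖ ^ 2)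
            (𝓝[<] 1) (𝓝 0) := by
          have := (tendsto_const_nhds (x := (1 : ℝ))).sub (hu.norm.pow 2) |>.sub (hv.norm.pow 2)
          rw [show 1 - ‖u‖ ^ 2 - ‖v‖ ^ 2 = 0 by linarith] at this
          simpa [circleMap] using this
        refine bdd_le_mul_tendsto_zero' (C ^ 2) (Eventually.of_forall fun r => ?_) e
        rw [abs_of_nonneg (by positivity)]
        gcongr
        exact bd _ _ hC _
    have key' := key.const_mul (2 * π)⁻¹
    simp only [intervalIntegral.integral_zero, mul_zero] at key'
    refine key'.congr' ?_
    filter_upwards [Ioo_mem_nhdsLT (show (0 : ℝ) < 1 by norm_num)] with r hr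
    have i1 := ((continuous_pow 2).comp (cont hg hr).norm).intervalIntegrable (μ := volume) 0 (2 * π)
    have i2 := ((continuous_pow 2).comp (cont hag hr).norm).intervalIntegrable (μ := volume) 0 (2 * π)
    have i3 := ((continuous_pow 2).comp (cont hbg hr).norm).intervalIntegrable (μ := volume) 0 (2 * π)
    simp only [Function.comp_def] at i1 i2 i3
    simp only [mean2, Real.circleAverage, smul_eq_mul]
    rw [← mul_add, ← mul_sub, ← intervalIntegral.integral_add i2 i3,
      ← intervalIntegral.integral_sub i1 (i2.add i3)]
    congr 1
    refine intervalIntegral.integral_congr fun θ _ => ?_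
    have ea : zeroExt (toeplitz a hba.a_mem g) = α * G := zeroExt_mul a g
    have eb : zeroExt (toeplitz b hba.b_mem g) = β * G := zeroExt_mul b g
    simp only [ea, eb, Pi.mul_apply, norm_mul, mul_pow, ← hG]
    ring
  refine (H2.isLUB_mean2 g).2 ?_
  rintro _ ⟨s, hs, rfl⟩
  refine ge_of_tendsto (x := 𝓝[<] (1 : ℝ))
    (f := fun r => (mean2 g r - (mean2 (toeplitz a hba.a_mem g) r +
      mean2 (toeplitz b hba.b_mem g) r)) + (‖toeplitz a hba.a_mem g‖ ^ 2 +
        ‖toeplitz b hba.b_mem g‖ ^ 2)) (by simpa using lim.add_const _) ?_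
  filter_upwards [Ioo_mem_nhdsLT hs.2] with r hr
  have hr' : r ∈ Set.Ico (0 : ℝ) 1 := ⟨hs.1.trans hr.1.le, hr.2⟩
  have h1 := monotone_mean2 hg hs.1 hr.1.le hr.2
  have h2 := (H2.isLUB_mean2 (toeplitz a hba.a_mem g)).1 ⟨r, hr', rfl⟩
  have h3 := (H2.isLUB_mean2 (toeplitz b hba.b_mem g)).1 ⟨r, hr', rfl⟩
  linarith

/-- One half of `‖g‖² = ‖a g‖² + ‖b g‖²`; it passes from polynomials to all of `H²` by density. -/
theorem norm_sq_le {b a : 𝔻 → ℂ} (hba : IsPythagoreanPair b a) (g : H2) :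
    ‖g‖ ^ 2 ≤ ‖toeplitz a hba.a_mem g‖ ^ 2 + ‖toeplitz b hba.b_mem g‖ ^ 2 := by
  have hcl : IsClosed {g : H2 | ‖g‖ ^ 2 ≤
      ‖toeplitz a hba.a_mem g‖ ^ 2 + ‖toeplitz b hba.b_mem g‖ ^ 2} :=
    isClosed_le (by fun_prop) (by fun_prop)
  refine hcl.closure_subset_iff.2 ?_ (dense_span_monomials g)
  intro p hp
  suffices h : ∃ C, ∀ z, ‖p z‖ ≤ C from norm_sq_le_of_bounded hba p h.choose_spec
  induction hp using Submodule.span_induction with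
  | mem x hx =>
    obtain ⟨n, rfl⟩ := hx
    refine ⟨1, fun z => ?_⟩
    simp only [shift_pow_one_apply, norm_pow]
    exact pow_le_one₀ (norm_nonneg _) z.norm_lt_one.le
  | zero => exact ⟨0, fun z => norm_zero.le⟩
  | add x y _ _ hx hy =>
    obtain ⟨C, hC⟩ := hx
    obtain ⟨D, hD⟩ := hy
    exact ⟨C + D, fun z => (norm_add_le _ _).trans (add_le_add (hC z) (hD z))⟩
  | smul c x _ hx =>
    obtain ⟨C, hC⟩ := hx
    exact ⟨‖c‖ * C, fun z => (norm_mul_le _ _).trans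
      (mul_le_mul_of_nonneg_left (hC z) (norm_nonneg c))⟩

/-! ### Pairs of Hardy functions with prescribed quotient -/

/-- The Hilbert space `H² ⊕ H²`. -/
abbrev H2Pair : Type := WithLp 2 (H2 × H2)

/-- The shift on `H² ⊕ H²`, acting in both coordinates. -/
noncomputable def pairShift : H2Pair →L[ℂ] H2Pair :=
  (WithLp.prodContinuousLinearEquiv 2 ℂ H2 H2).symm.toContinuousLinearMap ∘L
    (shift.prodMap shift) ∘L (WithLp.prodContinuousLinearEquiv 2 ℂ H2 H2).toContinuousLinearMap

/-- The operator `g ↦ (a g, b g)` from `H²` to `H² ⊕ H²`. -/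
noncomputable def pairToeplitz (a b : 𝔻 → ℂ) (ha : a ∈ HInfty) (hb : b ∈ HInfty) :
    H2 →L[ℂ] H2Pair :=
  (WithLp.prodContinuousLinearEquiv 2 ℂ H2 H2).symm.toContinuousLinearMap ∘L
    (toeplitz a ha).prod (toeplitz b hb)

theorem pairShift_fst (p : H2Pair) : (pairShift p).fst = shift p.fst := rfl
theorem pairShift_snd (p : H2Pair) : (pairShift p).snd = shift p.snd := rfl

theorem H2Pair.ext {p q : H2Pair} (h1 : ∀ z, p.fst z = q.fst z) (h2 : ∀ z, p.snd z = q.snd z) :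
    p = q :=
  WithLp.ofLp_injective 2 (Prod.ext (H2.ext' (funext h1)) (H2.ext' (funext h2)))

theorem inner_pairShift (p q : H2Pair) :
    inner ℂ (pairShift p) (pairShift q) = inner ℂ p q := by
  rw [WithLp.prod_inner_apply, WithLp.prod_inner_apply]
  exact congrArg₂ (· + ·) (inner_shift_shift _ _) (inner_shift_shift _ _)

theorem pairShift_pow_succ_apply (n : ℕ) (p : H2Pair) :
    (pairShift ^ (n + 1)) p = pairShift ((pairShift ^ n) p) := by
  rw [pow_succ']
  rfl

theorem pairShift_pow_apply (n : ℕ) (p : H2Pair) (z : 𝔻) :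
    ((pairShift ^ n) p).fst z = (z : ℂ) ^ n * p.fst z ∧
      ((pairShift ^ n) p).snd z = (z : ℂ) ^ n * p.snd z := by
  induction n with
  | zero => simp
  | succ n ih =>
    rw [pairShift_pow_succ_apply, pairShift_fst, pairShift_snd, shift_apply, shift_apply, ih.1,
      ih.2, pow_succ', mul_assoc, mul_assoc]
    exact ⟨rfl, rfl⟩

theorem inner_pairShift_pow (n m : ℕ) (p : H2Pair) :
    inner ℂ ((pairShift ^ m) p) ((pairShift ^ (m + n)) p) = inner ℂ p ((pairShift ^ n) p) := by
  induction m with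
  | zero => simp
  | succ m ih =>
    rw [add_right_comm, pairShift_pow_succ_apply, pairShift_pow_succ_apply, inner_pairShift, ih]

/-- The pairs `(x, y)` in `H² ⊕ H²` with `b x = a y`, that is, with `y / x = b / a`. For `b / a` in
the Smirnov class it is the graph of the unbounded operator of multiplication by `b / a`. -/
noncomputable def quotientGraph (a b : 𝔻 → ℂ) : Submodule ℂ H2Pair where
  carrier := {p | ∀ z, b z * p.fst z = a z * p.snd z}
  add_mem' {p q} hp hq z := by
    change b z * (p.fst z + q.fst z) = a z * (p.snd z + q.snd z)
    rw [mul_add, mul_add, hp z, hq z]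
  zero_mem' z := by
    change b z * 0 = a z * 0
    simp
  smul_mem' c p hp z := by
    change b z * (c * p.fst z) = a z * (c * p.snd z)
    rw [mul_left_comm, hp z, mul_left_comm]

theorem mem_quotientGraph {a b : 𝔻 → ℂ} {p : H2Pair} :
    p ∈ quotientGraph a b ↔ ∀ z, b z * p.fst z = a z * p.snd z := Iff.rfl

theorem continuous_H2_apply (z : 𝔻) : Continuous fun f : H2 => f z := by
  obtain ⟨k, hk⟩ := H2.exists_inner_eq_apply z
  simp_rw [← hk]
  fun_prop

theorem isClosed_quotientGraph (a b : 𝔻 → ℂ) : IsClosed (quotientGraph a b : Set H2Pair) := by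
  have : (quotientGraph a b : Set H2Pair) =
      ⋂ z, {p : H2Pair | b z * p.fst z = a z * p.snd z} := by
    ext p
    simp [mem_quotientGraph]
  rw [this]
  refine isClosed_iInter fun z => isClosed_eq ?_ ?_
  · exact continuous_const.mul ((continuous_H2_apply z).comp (WithLp.fstL 2 ℂ H2 H2).continuous)
  · exact continuous_const.mul ((continuous_H2_apply z).comp (WithLp.sndL 2 ℂ H2 H2).continuous)

theorem pairShift_pow_mem {a b : 𝔻 → ℂ} {p : H2Pair} (hp : p ∈ quotientGraph a b) (n : ℕ) :
    (pairShift ^ n) p ∈ quotientGraph a b := by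
  intro z
  rw [(pairShift_pow_apply n p z).1, (pairShift_pow_apply n p z).2, mul_left_comm, hp z,
    mul_left_comm]

theorem pairToeplitz_mem {a b : 𝔻 → ℂ} (ha : a ∈ HInfty) (hb : b ∈ HInfty) (g : H2) :
    pairToeplitz a b ha hb g ∈ quotientGraph a b :=
  fun z => mul_left_comm (b z) (a z) (g z)

theorem shift_injective : Function.Injective shift := by
  intro f g h
  rw [← sub_eq_zero] at h ⊢
  rw [← map_sub] at h
  rw [← inner_self_eq_zero (𝕜 := ℂ), ← inner_shift_shift, h, inner_zero_left]

/-- If the first coordinate of `k` vanishes at the origin, then so does the second, and `k` is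
divisible by the coordinate inside the space of pairs. -/
theorem exists_eq_pairShift {a b : 𝔻 → ℂ} (ha : a ∈ HInfty) (hb : b ∈ HInfty) (ha0 : a 0 ≠ 0)
    {k : H2Pair} (hk : k ∈ quotientGraph a b) (h0 : k.fst 0 = 0) :
    ∃ k' ∈ quotientGraph a b, k = pairShift k' := by
  have h1 : k.snd 0 = 0 := by
    have := hk 0
    rw [h0, mul_zero] at this
    exact (mul_eq_zero.1 this.symm).resolve_left ha0
  obtain ⟨x, hx⟩ := exists_eq_shift h0
  obtain ⟨y, hy⟩ := exists_eq_shift h1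
  refine ⟨WithLp.toLp 2 (x, y), ?_, H2Pair.ext (fun z => by rw [hx]; rfl) fun z => by rw [hy]; rfl⟩
  -- Injectivity of the shift covers the origin, where dividing by `z` pointwise fails.
  have h : toeplitz b hb x = toeplitz a ha y := by
    refine shift_injective ?_
    rw [← toeplitz_shift, ← toeplitz_shift, ← hx, ← hy]
    exact H2.ext' (funext hk)
  intro z
  exact congrArg (fun f : H2 => f z) h

/-- A wandering vector for the shift on the space of pairs: the orthogonal projection of `(1, 0)`,
which represents the functional `(x, y) ↦ x(0)`. -/
theorem exists_wandering_vector (a b : 𝔻 → ℂ) :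
    ∃ w ∈ quotientGraph a b, ∀ k ∈ quotientGraph a b, inner ℂ w k = k.fst 0 := by
  have := (isClosed_quotientGraph a b).completeSpace_coe
  let e : H2Pair := WithLp.toLp 2 (H2.one, 0)
  refine ⟨(quotientGraph a b).starProjection e, Submodule.starProjection_apply_mem _ _,
    fun k hk => ?_⟩
  rw [Submodule.inner_starProjection_left_eq_right, Submodule.starProjection_eq_self_iff.2 hk,
    WithLp.prod_inner_apply]
  have h1 := inner_shift_pow_one 0 k.fst
  rw [pow_zero, H2.taylorCoeff_zero] at h1
  have h2 : inner ℂ (0 : H2) k.snd = 0 := inner_zero_left _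
  exact (congrArg₂ (· + ·) h1 h2).trans (add_zero _)

/-- A pair orthogonal to the whole orbit of the wandering vector is divisible by every power of the
coordinate, hence vanishes. -/
theorem eq_zero_of_inner_orbit {a b : 𝔻 → ℂ} (ha : a ∈ HInfty) (hb : b ∈ HInfty) (ha0 : a 0 ≠ 0)
    {w : H2Pair} (hw : ∀ k ∈ quotientGraph a b, inner ℂ w k = k.fst 0) {k : H2Pair}
    (hk : k ∈ quotientGraph a b) (h : ∀ n, inner ℂ ((pairShift ^ n) w) k = 0) : k = 0 := by
  have key : ∀ n, ∀ k ∈ quotientGraph a b, (∀ n, inner ℂ ((pairShift ^ n) w) k = 0) →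
      taylorCoeff k.fst n = 0 ∧ taylorCoeff k.snd n = 0 := by
    intro n
    induction n with
    | zero =>
      intro k hk h
      have h0 : k.fst 0 = 0 := by rw [← hw k hk]; exact h 0
      obtain ⟨k', -, rfl⟩ := exists_eq_pairShift ha hb ha0 hk h0
      exact ⟨(taylorCoeff_shift _).1, (taylorCoeff_shift _).1⟩
    | succ n ih =>
      intro k hk h
      have h0 : k.fst 0 = 0 := by rw [← hw k hk]; exact h 0
      obtain ⟨k', hk', rfl⟩ := exists_eq_pairShift ha hb ha0 hk h0
      rw [pairShift_fst, pairShift_snd, (taylorCoeff_shift _).2, (taylorCoeff_shift _).2]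
      refine ih k' hk' fun m => ?_
      rw [← inner_pairShift, ← pairShift_pow_succ_apply]
      exact h (m + 1)
  refine WithLp.ofLp_injective 2 (Prod.ext ?_ ?_)
  · exact H2.eq_zero_of_taylorCoeff fun n => (key n k hk h).1
  · exact H2.eq_zero_of_taylorCoeff fun n => (key n k hk h).2

/-- The space of pairs is a copy of `H²`: for a suitable pair `w` in it, `f ↦ f w` is an isometry of
`H²` onto it. This is Beurling's theorem for a space of multiplicity one. -/
theorem exists_isometry_onto_quotientGraph {a b : 𝔻 → ℂ} (ha : a ∈ HInfty) (hb : b ∈ HInfty)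
    (ha0 : a 0 ≠ 0) :
    ∃ w ∈ quotientGraph a b, ∃ T : H2 →ₗᵢ[ℂ] H2Pair,
      (∀ f z, (T f).fst z = f z * w.fst z ∧ (T f).snd z = f z * w.snd z) ∧
      ∀ k ∈ quotientGraph a b, ∃ f, T f = k := by
  obtain ⟨w₀, hw₀, hrep⟩ := exists_wandering_vector a b
  have hne : w₀ ≠ 0 := by
    rintro rfl
    have h := hrep _ (pairToeplitz_mem ha hb H2.one)
    rw [inner_zero_left] at h
    exact ha0 ((mul_one (a 0)).symm.trans h.symm)
  have hn : ‖w₀‖ ≠ 0 := norm_ne_zero_iff.2 hne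
  let w : H2Pair := ((‖w₀‖ : ℂ)⁻¹) • w₀
  have hw : w ∈ quotientGraph a b := Submodule.smul_mem _ _ hw₀
  have hw1 : ‖w‖ = 1 := by simp [w, norm_smul, hn]
  have hpos : ∀ n, inner ℂ w ((pairShift ^ n) w) = if n = 0 then 1 else 0 := by
    intro n
    rcases n with _ | n
    · simp [inner_self_eq_norm_sq_to_K, hw1]
    · rw [if_neg n.succ_ne_zero, inner_smul_left, hrep _ (pairShift_pow_mem hw _),
        (pairShift_pow_apply _ _ _).1]
      simp
  have horth : Orthonormal ℂ fun n : ℕ => (pairShift ^ n) w := by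
    rw [orthonormal_iff_ite]
    intro i j
    rcases le_total i j with h | h
    · obtain ⟨n, rfl⟩ := Nat.exists_eq_add_of_le h
      rw [inner_pairShift_pow, hpos]
      simp
    · obtain ⟨n, rfl⟩ := Nat.exists_eq_add_of_le h
      rw [← inner_conj_symm, inner_pairShift_pow, hpos]
      split_ifs <;> simp_all
  let T : H2 →ₗᵢ[ℂ] H2Pair := horth.orthogonalFamily.linearIsometry.comp H2.toLp.toLinearIsometry
  have hT : ∀ f : H2, HasSum (fun n => taylorCoeff f n • (pairShift ^ n) w) (T f) := fun f =>
    horth.orthogonalFamily.hasSum_linearIsometry (H2.toLp f)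
  have hev : ∀ (L : H2Pair →L[ℂ] H2) (z : 𝔻),
      (∀ n, L ((pairShift ^ n) w) z = (z : ℂ) ^ n * L w z) →
      ∀ f, L (T f) z = f z * L w z := by
    intro L z hL f
    obtain ⟨k, hk⟩ := H2.exists_inner_eq_apply z
    have h1 := (innerSL ℂ k).hasSum (L.hasSum (hT f))
    refine (hk _).symm.trans (h1.unique ?_)
    convert (H2.hasSum f z).mul_right (L w z) using 2 with n
    · rfl
    · simp only [map_smul, smul_eq_mul, innerSL_apply_apply, hk, hL, mul_assoc]
  refine ⟨w, hw, T, fun f z => ⟨?_, ?_⟩, fun k hk => ?_⟩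
  · exact hev (WithLp.fstL 2 ℂ H2 H2) z (fun n => (pairShift_pow_apply n w z).1) f
  · exact hev (WithLp.sndL 2 ℂ H2 H2) z (fun n => (pairShift_pow_apply n w z).2) f
  · have hTmem : ∀ f, T f ∈ quotientGraph a b := fun f =>
      (isClosed_quotientGraph a b).mem_of_tendsto (hT f) (Eventually.of_forall fun s =>
        Submodule.sum_mem _ fun n _ => Submodule.smul_mem _ _ (pairShift_pow_mem hw n))
    have hTone : ∀ n, T ((shift ^ n) H2.one) = (pairShift ^ n) w := by
      intro n
      refine (hT _).unique ?_
      convert hasSum_ite_eq n ((pairShift ^ n) w) using 2 with m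
      rw [taylorCoeff_shift_pow_one]
      split_ifs with h <;> simp [h]
    let A := T.toContinuousLinearMap.adjoint
    refine ⟨A k, (sub_eq_zero.1 ?_).symm⟩
    refine eq_zero_of_inner_orbit ha hb ha0 hrep (Submodule.sub_mem _ hk (hTmem _)) fun n => ?_
    have hsc : (pairShift ^ n) w₀ = (‖w₀‖ : ℂ) • (pairShift ^ n) w := by
      rw [← map_smul, smul_inv_smul₀ (by exact_mod_cast hn)]
    rw [hsc, inner_smul_left, ← hTone, inner_sub_right, T.inner_map_map]
    have := ContinuousLinearMap.adjoint_inner_right T.toContinuousLinearMap ((shift ^ n) H2.one) k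
    rw [show inner ℂ ((shift ^ n) H2.one) (A k) = inner ℂ (T ((shift ^ n) H2.one)) k from this]
    simp

/-- If `b / a` is the quotient of a Pythagorean pair and `x`, `(b / a) x` both lie in `H²`, then
`x = a g` with `g` in `H²`. -/
theorem exists_eq_pairToeplitz {b a : 𝔻 → ℂ} (hba : IsPythagoreanPair b a) {k : H2Pair}
    (hk : k ∈ quotientGraph a b) : ∃ g, pairToeplitz a b hba.a_mem hba.b_mem g = k := by
  have ha0 : a 0 ≠ 0 := by
    obtain ⟨c, hc, h⟩ := hba.a_zero
    rw [h]
    exact_mod_cast hc.ne'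
  obtain ⟨w, hw, T, hT, hsurj⟩ := exists_isometry_onto_quotientGraph hba.a_mem hba.b_mem ha0
  set V := pairToeplitz a b hba.a_mem hba.b_mem with hV
  have hVcl : IsClosed (V.range : Set H2Pair) := by
    refine (V.antilipschitz_of_bound (K := 1) fun g => ?_).isClosed_range V.uniformContinuous
    refine le_of_sq_le_sq ?_ (by positivity)
    rw [NNReal.coe_one, one_mul, WithLp.prod_norm_sq_eq_of_L2]
    exact norm_sq_le hba g
  -- The functions `f` with `f w` in the range of `V` form a closed shift-invariant subspace of `H²`;
  -- it contains `a`, because `a w = V w.fst` by the relation defining the space of pairs.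
  let M : Submodule ℂ H2 := V.range.comap T.toLinearMap
  have hMcl : IsClosed (M : Set H2) := hVcl.preimage T.continuous
  have hTS : ∀ f, T (shift f) = pairShift (T f) := by
    intro f
    refine H2Pair.ext (fun z => ?_) fun z => ?_
    · rw [(hT _ z).1, pairShift_fst, shift_apply, shift_apply, (hT f z).1, mul_assoc]
    · rw [(hT _ z).2, pairShift_snd, shift_apply, shift_apply, (hT f z).2, mul_assoc]
  have hVS : ∀ g, V (shift g) = pairShift (V g) := fun g =>
    H2Pair.ext (fun z => mul_left_comm (a z) (z : ℂ) (g z)) fun z =>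
      mul_left_comm (b z) (z : ℂ) (g z)
  obtain ⟨h', hc⟩ := hba.a_outer
  have hMtop : M = ⊤ := by
    rw [eq_top_iff, ← hc]
    refine Submodule.topologicalClosure_minimal _ ?_ hMcl
    rw [Submodule.span_le]
    rintro _ ⟨n, rfl⟩
    change (shift ^ n) (H2.of a h') ∈ M
    induction n with
    | zero =>
      refine ⟨w.fst, H2Pair.ext (fun z => ?_) fun z => ?_⟩
      · exact ((hT (H2.of a h') z).1).symm
      · exact (hw z).trans ((hT (H2.of a h') z).2).symm
    | succ n ih =>
      obtain ⟨g, hg⟩ := ih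
      refine ⟨shift g, (hVS g).trans ?_⟩
      rw [shift_pow_succ_apply]
      exact (congrArg pairShift hg).trans (hTS _).symm
  obtain ⟨f, rfl⟩ := hsurj k hk
  exact (hMtop ▸ Submodule.mem_top : f ∈ M)

/-! ### The de Branges–Rovnyak space -/

theorem sqrt_one_sub_spec {T : H2 →L[ℂ] H2} (hT : ∀ f, ‖T f‖ ≤ ‖f‖) :
    IsSelfAdjoint (CFC.sqrt (1 - T ∘L T.adjoint)) ∧
      CFC.sqrt (1 - T ∘L T.adjoint) * CFC.sqrt (1 - T ∘L T.adjoint) = 1 - T ∘L T.adjoint := by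
  have h : 0 ≤ 1 - T ∘L T.adjoint := by
    have hn : ‖T‖ ≤ 1 := T.opNorm_le_bound zero_le_one (by simpa using hT)
    refine sub_nonneg.2 ((CStarAlgebra.norm_le_one_iff_of_nonneg (T * star T)
      (mul_star_self_nonneg T)).1 ?_)
    rw [CStarRing.norm_self_mul_star]
    exact mul_le_one₀ hn (norm_nonneg _) hn
  exact ⟨(CFC.sqrt_nonneg _).isSelfAdjoint, CFC.sqrt_mul_sqrt_self _ h⟩

/-- For `f = (I - T_b T_b^*)^{1/2} u` the functional `b g ↦ ⟨b g, f⟩` is controlled by `‖a g‖`. -/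
theorem exists_bound_of_mem_deBrangesRovnyak {b a : 𝔻 → ℂ} (hba : IsPythagoreanPair b a) {f : H2}
    (hf : f ∈ deBrangesRovnyak b hba.b_mem) :
    ∃ C : ℝ, ∀ g, ‖inner ℂ (toeplitz b hba.b_mem g) f‖ ≤ C * ‖toeplitz a hba.a_mem g‖ := by
  obtain ⟨u, rfl⟩ := hf
  set T := toeplitz b hba.b_mem
  have hTn : ∀ f, ‖T f‖ ≤ ‖f‖ := norm_toeplitz_apply_le hba.b_mem hba.b_le
  obtain ⟨hsa, hsq⟩ := sqrt_one_sub_spec hTn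
  set D := CFC.sqrt (1 - T ∘L T.adjoint)
  have hsymm : ∀ x y, inner ℂ (D x) y = inner ℂ x (D y) := hsa.isSymmetric
  refine ⟨‖u‖, fun g => ?_⟩
  have hD : ‖D (T g)‖ ^ 2 = ‖T g‖ ^ 2 - ‖T.adjoint (T g)‖ ^ 2 := by
    have e : D (D (T g)) = T g - T (T.adjoint (T g)) := congrArg (fun L => L (T g)) hsq
    rw [← inner_self_eq_norm_sq (𝕜 := ℂ), hsymm, e, inner_sub_right, map_sub,
      inner_self_eq_norm_sq, ← ContinuousLinearMap.adjoint_inner_left, inner_self_eq_norm_sq]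
  have hQ : ‖g - T.adjoint (T g)‖ ^ 2 = ‖g‖ ^ 2 - 2 * ‖T g‖ ^ 2 + ‖T.adjoint (T g)‖ ^ 2 := by
    rw [norm_sub_sq (𝕜 := ℂ), ContinuousLinearMap.adjoint_inner_right, inner_self_eq_norm_sq]
  have hle : ‖D (T g)‖ ≤ ‖toeplitz a hba.a_mem g‖ := by
    refine le_of_sq_le_sq ?_ (norm_nonneg _)
    nlinarith [norm_sq_le hba g, sq_nonneg ‖g - T.adjoint (T g)‖]
  calc ‖inner ℂ (T g) (D u)‖ = ‖inner ℂ (D (T g)) u‖ := by rw [hsymm]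
    _ ≤ ‖D (T g)‖ * ‖u‖ := norm_inner_le_norm _ _
    _ ≤ ‖u‖ * ‖toeplitz a hba.a_mem g‖ := by
      rw [mul_comm]
      gcongr

/-- In a Pythagorean pair with `b / a` a unit of the Smirnov class, multiplication by `b` has dense
range: `b g = a h` for some bounded outer `h` and bounded `g`. -/
theorem denseRange_toeplitz_of_unit {φ b a : 𝔻 → ℂ} (hφ : IsSmirnovUnit φ)
    (hba : IsPythagoreanPair b a) (hq : ∀ z, φ z = b z / a z) :
    DenseRange (toeplitz b hba.b_mem) := by
  obtain ⟨-, ψ, ⟨g, hg, h, hh, hho, hψ⟩, hφψ⟩ := hφ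
  have hdense := (denseRange_toeplitz hba.a_mem hba.a_outer).comp (denseRange_toeplitz hh hho)
    (toeplitz a hba.a_mem).continuous
  refine hdense.mono ?_
  rintro _ ⟨f, rfl⟩
  refine ⟨toeplitz g hg f, H2.ext' (funext fun z => ?_)⟩
  have h1 := hφψ z
  rw [hq, hψ, div_mul_div_comm] at h1
  have h2 := (div_eq_one_iff_eq fun h0 => by rw [h0, div_zero] at h1; exact zero_ne_one h1).1 h1
  change b z * (g z * f z) = a z * (h z * f z)
  rw [← mul_assoc, h2, mul_assoc]

end HardyDisc

theorem mainTheorem7 (φ b a : 𝔻 → ℂ) (hφ : IsSmirnovUnit φ)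
    (hba : IsPythagoreanPair b a) (hq : ∀ z, φ z = b z / a z)
    (hc : IsCompleteInH2 fun (k : {k : ℕ // 2 ≤ k}) (z : 𝔻) => hFun k z / φ z) :
    spanHᗮ ⊓ deBrangesRovnyak b hba.b_mem = ⊥ := by
  have hφ0 : ∀ z, φ z ≠ 0 := by
    obtain ⟨-, ψ, -, h⟩ := hφ
    exact fun z => left_ne_zero_of_mul_eq_one (h z)
  obtain ⟨hf, hdense⟩ := hc
  set V := pairToeplitz a b hba.a_mem hba.b_mem
  -- `h_k / φ = a g_k` and `h_k = b g_k` with `g_k` in `H²`.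
  have hex : ∀ k, ∃ g, V g = WithLp.toLp 2 (H2.of _ (hf k), hVec k) := by
    refine fun k => exists_eq_pairToeplitz hba fun z => ?_
    change b z * (hFun k z / φ z) = a z * hFun k z
    have ha : a z ≠ 0 := fun h => hφ0 z (by rw [hq, h, div_zero])
    have hb : b z = φ z * a z := by rw [hq, div_mul_cancel₀ _ ha]
    rw [hb]
    field_simp [hφ0 z]
  choose g hg using hex
  have hga : ∀ k, toeplitz a hba.a_mem (g k) = H2.of _ (hf k) := fun k =>
    congrArg (fun p : H2Pair => p.fst) (hg k)
  have hgb : ∀ k, toeplitz b hba.b_mem (g k) = hVec k := fun k =>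
    congrArg (fun p : H2Pair => p.snd) (hg k)
  rw [Submodule.eq_bot_iff]
  rintro f ⟨hfN, hfb⟩
  obtain ⟨C, hC⟩ := exists_bound_of_mem_deBrangesRovnyak hba hfb
  set P := Submodule.span ℂ (Set.range g)
  have hP : ∀ p ∈ P, inner ℂ (toeplitz b hba.b_mem p) f = 0 := by
    intro p hp
    refine hfN _ ?_
    have : P ≤ spanH.comap (toeplitz b hba.b_mem).toLinearMap := by
      rw [Submodule.span_le]
      rintro _ ⟨k, rfl⟩
      change toeplitz b hba.b_mem (g k) ∈ spanH
      rw [hgb]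
      exact Submodule.subset_span ⟨k, rfl⟩
    exact this hp
  have hPdense : Dense (P.map (toeplitz a hba.a_mem).toLinearMap : Set H2) := by
    rw [Submodule.dense_iff_topologicalClosure_eq_top, Submodule.map_span, ← Set.range_comp,
      ← hdense]
    congr 3
    exact funext hga
  -- Approximating `a q` by `a p` with `p` in the span of the `g_k` gives `⟨b q, f⟩ = 0` for all `q`.
  have hzero : ∀ q, inner ℂ (toeplitz b hba.b_mem q) f = 0 := by
    intro q
    rw [← norm_le_zero_iff]
    have hcl : IsClosed {y : H2 | ‖inner ℂ (toeplitz b hba.b_mem q) f‖ ≤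
        C * ‖toeplitz a hba.a_mem q - y‖} := isClosed_le (by fun_prop) (by fun_prop)
    have hmem := hcl.closure_subset_iff.2 ?_ (hPdense (toeplitz a hba.a_mem q))
    · simpa using hmem
    · rintro _ ⟨p, hp, rfl⟩
      have h := hC (q - p)
      rw [map_sub, inner_sub_left, hP p hp, sub_zero, map_sub] at h
      exact h
  refine Dense.eq_zero_of_inner_right ℂ (denseRange_toeplitz_of_unit hφ hba hq) ?_
  rintro _ ⟨q, rfl⟩
  exact hzero q
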